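/- Theorem (permutability). Let $\mathbb E$ be a regular category, that is, a finitely complete category in which regular epimorphisms are stable under pullback and every kernel pair has a coequalizer. A relation $R$ from $X$ to $Y$ is a subobject $\langle r_0,r_1\rangle\colon R\rightarrowtail X\times Y$ (a relation on $X$ if $Y=X$); its opposite $R^\circ$ is the subobject $\langle r_1,r_0\rangle\colon R\rightarrowtail Y\times X$; and the composite $S\circ R$ of $R$ with a relation $\langle s_0,s_1\rangle\colon S\rightarrowtail Y\times Z$ is the monomorphic part of the (regular epi)-mono factorization of $\langle r_0\pi_0,s_1\pi_1\rangle\colon R\times_Y S\to X\times Z$, where $\pi_0,\pi_1$ are the projections of the pullback of $r_1$ and $s_0$. A relation $U$ from $X$ to $Y$ is difunctional if $U\circ U^\circ\circ U\leqslant U$. A relation $R$ on $X$ is reflexive if $r_0$ and $r_1$ have a common section $X\to R$; symmetric if there is $s\colon R\to R$ with $r_0s=r_1$ and $r_1s=r_0$; transitive if there is $t\colon R\times_XR\to R$ with $r_0t=r_0\pi_0$ and $r_1t=r_1\pi_1$, where $R\times_XR$ is the pullback of $r_1$ and $r_0$, with projections $\pi_0,\pi_1$; and an equivalence relation if it is reflexive,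 symmetric and transitive. A finitely complete category is a Mal'tsev category if every reflexive relation in it is an equivalence relation. The following conditions are equivalent: 1. for any two equivalence relations $R$ and $S$ on any object $X$ of $\mathbb E$, $S\circ R=R\circ S$; 2. for any objects $X,Y$ of $\mathbb E$, every relation $U$ from $X$ to $Y$ is difunctional; 3. $\mathbb E$ is a Mal'tsev category; 4. every reflexive relation on any object of $\mathbb E$ is symmetric; 5. every reflexive relation on any object of $\mathbb E$ is transitive. -/

import Mathlib

open CategoryTheory CategoryTheory.Limits

universe v u

namespace InternalRelation

variable {C : Type u} [Category.{v} C]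

/-- A relation from `X` to `Y` is a subobject of the product `X ⨯ Y`. -/
abbrev Relation [HasFiniteLimits C] (X Y : C) := Subobject (X ⨯ Y)

/-- The first projection `r₀ : R ⟶ X` of a relation `⟨r₀, r₁⟩ : R ↣ X ⨯ Y`. -/
noncomputable def proj₀ [HasFiniteLimits C] {X Y : C} (R : Relation X Y) : (R : C) ⟶ X :=
  R.arrow ≫ prod.fst

/-- The second projection `r₁ : R ⟶ Y` of a relation `⟨r₀, r₁⟩ : R ↣ X ⨯ Y`. -/
noncomputable def proj₁ [HasFiniteLimits C] {X Y : C} (R : Relation X Y) : (R : C) ⟶ Y :=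
  R.arrow ≫ prod.snd

/-- The two projections of a relation are jointly monic. -/
theorem proj_ext [HasFiniteLimits C] {X Y : C} (R : Relation X Y) {Z : C} {a b : Z ⟶ (R : C)}
    (h₀ : a ≫ proj₀ R = b ≫ proj₀ R) (h₁ : a ≫ proj₁ R = b ≫ proj₁ R) : a = b := by
  rw [← cancel_mono R.arrow]
  ext
  · simpa [proj₀] using h₀
  · simpa [proj₁] using h₁

instance mono_lift_proj₁_proj₀ [HasFiniteLimits C] {X Y : C} (R : Relation X Y) :
    Mono (prod.lift (proj₁ R) (proj₀ R)) where
  right_cancellation a b h := proj_ext R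
    (by simpa [prod.lift_snd] using congrArg (fun k => k ≫ prod.snd) h)
    (by simpa [prod.lift_fst] using congrArg (fun k => k ≫ prod.fst) h)

/-- The opposite relation `R°` from `Y` to `X`: the subobject `⟨r₁, r₀⟩ : R ↣ Y ⨯ X`. -/
noncomputable def opposite [HasFiniteLimits C] {X Y : C} (R : Relation X Y) : Relation Y X :=
  Subobject.mk (prod.lift (proj₁ R) (proj₀ R))

/-- The composite `S ∘ R` (first `R`, then `S`): the monomorphic part of the
(regular epi, mono)-factorization of `⟨r₀ π₀, s₁ π₁⟩ : R ×_Y S ⟶ X ⨯ Z`, where `π₀` and `π₁` are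
the projections of the pullback of `r₁` and `s₀`. -/
noncomputable def comp [Regular C] {X Y Z : C} (S : Relation Y Z) (R : Relation X Y) :
    Relation X Z :=
  Subobject.mk (Regular.strongEpiMonoFactorisation
    (prod.lift (pullback.fst (proj₁ R) (proj₀ S) ≫ proj₀ R)
      (pullback.snd (proj₁ R) (proj₀ S) ≫ proj₁ S))).m

/-- `R` is reflexive: there is a common section `X ⟶ R` of `r₀` and `r₁`. -/
def IsReflexive [HasFiniteLimits C] {X : C} (R : Relation X X) : Prop :=
  Nonempty (ReflexiveRelation (proj₀ R) (proj₁ R))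

/-- `R` is symmetric: there is `s : R ⟶ R` interchanging `r₀` and `r₁`. -/
def IsSymmetric [HasFiniteLimits C] {X : C} (R : Relation X X) : Prop :=
  Nonempty (SymmetricRelation (proj₀ R) (proj₁ R))

/-- `R` is transitive: there is `t : R ×_X R ⟶ R` with `r₀ t = r₀ π₀` and `r₁ t = r₁ π₁`, where
`R ×_X R` is the pullback of `r₁` and `r₀`. -/
def IsTransitive [HasFiniteLimits C] {X : C} (R : Relation X X) : Prop :=
  Nonempty (TransitiveRelation (proj₀ R) (proj₁ R))

/-- `R` is an (internal) equivalence relation: reflexive, symmetric and transitive. -/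
def IsEquivalence [HasFiniteLimits C] {X : C} (R : Relation X X) : Prop :=
  IsEquivalenceRelation (proj₀ R) (proj₁ R)

/-- `U` is difunctional: `U ∘ U° ∘ U ≤ U`. -/
def IsDifunctional [Regular C] {X Y : C} (U : Relation X Y) : Prop :=
  comp U (comp (opposite U) U) ≤ U

/-- A finitely complete category is a Mal'tsev category when every reflexive relation in it is an
equivalence relation. -/
def IsMaltsev (C : Type u) [Category.{v} C] [HasFiniteLimits C] : Prop :=
  ∀ (X : C) (R : Relation X X), IsReflexive R → IsEquivalence R

end InternalRelation

/-!
A relation `R` from `X` to `Y` is determined by the pairs of generalized elements `x : T ⟶ X`,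
`y : T ⟶ Y` that it relates, and these can be manipulated as elements of sets. In a regular category
`S ∘ R` relates `x` to `z` when an intermediate element exists after pulling back along a regular
epimorphism; since being related descends along regular epimorphisms, such covers are harmless.

Let `U` relate `a` to `b`, `c` to `b`, and `c` to `d`; difunctionality asks that `a U d`. View
`(a, b)`, `(c, b)`, `(c, d)` as elements of the object `U`.

* The kernel pairs of the two projections of `U` link `(a, b)` to `(c, d)` through `(c, b)`. If they
  permute, then they also link them through an element with first entry `a` and second entry `d`.
* The relation on `U` linking `(a, b)` to `(c, d)` when `a U d` is reflexive. It links `(c, d)` to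
  `(a, b)` because `c U b`, and it links `(a, b)` to `(c, b)` and `(c, b)` to `(c, d)`. So symmetry
  and transitivity each give `a U d`.

Conversely, a reflexive difunctional `R` is symmetric (from `y R y`, `x R y`, `x R x`) and
transitive (from `x R y`, `y R y`, `y R z`). Finally, if `R` and `S` are equivalence relations and
the reflexive relation `S ∘ R` is symmetric, then `S ∘ R = (S ∘ R)° = R° ∘ S° = R ∘ S`.
-/

namespace InternalRelation

variable {C : Type u} [Category.{v} C]

theorem prod_lift_eq_lift_iff {T X Y : C} [HasBinaryProduct X Y] {x x' : T ⟶ X} {y y' : T ⟶ Y} :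
    prod.lift x y = prod.lift x' y' ↔ x = x' ∧ y = y' := by
  rw [prod.hom_ext_iff]
  simp only [prod.lift_fst, prod.lift_snd]

theorem factors_strongEpi_comp_iff {T T' Y : C} {P : Subobject Y} (e : T' ⟶ T) [StrongEpi e]
    {f : T ⟶ Y} : P.Factors (e ≫ f) ↔ P.Factors f := by
  refine ⟨fun h => ?_, Subobject.factors_of_factors_right e⟩
  have sq : CommSq (P.factorThru _ h) e P.arrow f := ⟨P.factorThru_arrow _ h⟩
  simpa only [sq.fac_right] using Subobject.factors_comp_arrow (P := P) sq.lift

theorem mk_factors_iff_exists {A T Y : C} {m : A ⟶ Y} [Mono m] {g : T ⟶ Y} :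
    (Subobject.mk m).Factors g ↔ ∃ k : T ⟶ A, k ≫ m = g :=
  Iff.rfl

theorem mk_monoFactorisation_m_factors_iff [Regular C] {A B T : C} {f : A ⟶ B}
    (F : MonoFactorisation f) [IsRegularEpi F.e] {g : T ⟶ B} :
    (Subobject.mk F.m).Factors g ↔
      ∃ (T' : C) (e : T' ⟶ T) (k : T' ⟶ A), IsRegularEpi e ∧ k ≫ f = e ≫ g := by
  rw [mk_factors_iff_exists]
  constructor
  · rintro ⟨k, rfl⟩
    refine ⟨_, pullback.snd F.e k, pullback.fst F.e k, inferInstance, ?_⟩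
    rw [← pullback.condition_assoc, F.fac]
  · rintro ⟨T', e, k, _, hk⟩
    refine (factors_strongEpi_comp_iff e).1 (mk_factors_iff_exists.2 ⟨k ≫ F.e, ?_⟩)
    rw [Category.assoc, F.fac, hk]

section FiniteLimits

variable [HasFiniteLimits C] {X Y T T' : C}

theorem prod_lift_proj (R : Relation X Y) : prod.lift (proj₀ R) (proj₁ R) = R.arrow := by
  rw [proj₀, proj₁, ← prod.comp_lift, prod.lift_fst_snd, Category.comp_id]

/-- The generalized elements `x : T ⟶ X` and `y : T ⟶ Y` are related by `R`: the pair `⟨x, y⟩`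
factors through the subobject `R` of `X ⨯ Y`. -/
def Relates (R : Relation X Y) (x : T ⟶ X) (y : T ⟶ Y) : Prop :=
  R.Factors (prod.lift x y)

theorem Relates.precomp {R : Relation X Y} {x : T ⟶ X} {y : T ⟶ Y} (h : Relates R x y)
    (e : T' ⟶ T) : Relates R (e ≫ x) (e ≫ y) := by
  rw [Relates, ← prod.comp_lift]
  exact Subobject.factors_of_factors_right e h

theorem relates_strongEpi_comp_iff {R : Relation X Y} {x : T ⟶ X} {y : T ⟶ Y} (e : T' ⟶ T)
    [StrongEpi e] : Relates R (e ≫ x) (e ≫ y) ↔ Relates R x y := by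
  rw [Relates, ← prod.comp_lift, factors_strongEpi_comp_iff, Relates]

theorem relates_proj (R : Relation X Y) : Relates R (proj₀ R) (proj₁ R) := by
  rw [Relates, prod_lift_proj]
  exact R.factors_self

theorem relates_iff_exists {R : Relation X Y} {x : T ⟶ X} {y : T ⟶ Y} :
    Relates R x y ↔ ∃ k : T ⟶ (R : C), k ≫ proj₀ R = x ∧ k ≫ proj₁ R = y := by
  simp only [← prod_lift_eq_lift_iff, ← prod.comp_lift, prod_lift_proj]
  exact R.factors_iff _

theorem le_iff_forall_relates {R S : Relation X Y} :
    R ≤ S ↔ ∀ ⦃T : C⦄ (x : T ⟶ X) (y : T ⟶ Y), Relates R x y → Relates S x y := by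
  refine ⟨fun h T x y => Subobject.factors_of_le _ h, fun h => Subobject.le_of_factors ?_⟩
  rw [← prod_lift_proj]
  exact h _ _ (relates_proj R)

theorem relates_opposite_iff {R : Relation X Y} {x : T ⟶ X} {y : T ⟶ Y} :
    Relates (opposite R) y x ↔ Relates R x y := by
  rw [Relates, opposite, mk_factors_iff_exists, relates_iff_exists]
  simp only [prod.comp_lift, prod_lift_eq_lift_iff, and_comm]

theorem isReflexive_iff {R : Relation X X} :
    IsReflexive R ↔ ∀ ⦃T : C⦄ (x : T ⟶ X), Relates R x x := by
  constructor
  · rintro ⟨h⟩ T x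
    exact relates_iff_exists.2 ⟨x ≫ h.r, by simp, by simp⟩
  · intro h
    obtain ⟨r, h₀, h₁⟩ := relates_iff_exists.1 (h (𝟙 X))
    exact ⟨{ right_cancellation _ _ _ := proj_ext R
             r := r
             reflexivity₁ := h₀
             reflexivity₂ := h₁ }⟩

theorem isSymmetric_iff {R : Relation X X} :
    IsSymmetric R ↔ ∀ ⦃T : C⦄ (x y : T ⟶ X), Relates R x y → Relates R y x := by
  simp only [relates_iff_exists]
  constructor
  · rintro ⟨h⟩ T _ _ ⟨k, rfl, rfl⟩
    exact ⟨k ≫ h.s, by simp, by simp⟩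
  · intro h
    obtain ⟨s, h₀, h₁⟩ := h (proj₀ R) (proj₁ R) ⟨𝟙 _, Category.id_comp _, Category.id_comp _⟩
    exact ⟨{ right_cancellation _ _ _ := proj_ext R
             s := s
             symmetry₁ := h₀
             symmetry₂ := h₁ }⟩

theorem isTransitive_iff {R : Relation X X} :
    IsTransitive R ↔
      ∀ ⦃T : C⦄ (x y z : T ⟶ X), Relates R x y → Relates R y z → Relates R x z := by
  constructor
  · rintro ⟨h⟩ T x y z hxy hyz
    obtain ⟨k, rfl, rfl⟩ := relates_iff_exists.1 hxy
    obtain ⟨l, hl, rfl⟩ := relates_iff_exists.1 hyz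
    obtain ⟨m, hk, hl⟩ := PullbackCone.IsLimit.lift' h.isLimit k l hl.symm
    exact relates_iff_exists.2 ⟨m ≫ h.t, by simp [reassoc_of% hk], by simp [reassoc_of% hl]⟩
  · intro h
    let π₀ := pullback.fst (proj₁ R) (proj₀ R)
    let π₁ := pullback.snd (proj₁ R) (proj₀ R)
    have hπ : π₀ ≫ proj₁ R = π₁ ≫ proj₀ R := pullback.condition
    obtain ⟨t, h₀, h₁⟩ := relates_iff_exists.1
      (h _ _ _ ((relates_proj R).precomp π₀) (hπ ▸ (relates_proj R).precomp π₁))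
    exact ⟨{ right_cancellation _ _ _ := proj_ext R
             c := _
             isLimit := pullbackIsPullback (proj₁ R) (proj₀ R)
             t := t
             transitivity₁ := h₀
             transitivity₂ := h₁ }⟩

theorem isEquivalence_iff {R : Relation X X} :
    IsEquivalence R ↔ IsReflexive R ∧ IsSymmetric R ∧ IsTransitive R := by
  constructor
  · rintro ⟨⟨h⟩⟩
    exact ⟨⟨h.toReflexiveRelation⟩, ⟨h.toSymmetricRelation⟩, ⟨h.toTransitiveRelation⟩⟩
  · rintro ⟨⟨hr⟩, ⟨hs⟩, ⟨ht⟩⟩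
    exact ⟨⟨{ hr, hs, ht with }⟩⟩

/-- The kernel pair of `f`, as a relation. -/
noncomputable def kernelRelation (f : X ⟶ Y) : Relation X X :=
  equalizerSubobject (prod.fst ≫ f) (prod.snd ≫ f)

theorem relates_kernelRelation_iff {f : X ⟶ Y} {x y : T ⟶ X} :
    Relates (kernelRelation f) x y ↔ x ≫ f = y ≫ f := by
  rw [Relates, kernelRelation, equalizerSubobject_factors_iff, prod.lift_fst_assoc,
    prod.lift_snd_assoc]

theorem isEquivalence_kernelRelation (f : X ⟶ Y) : IsEquivalence (kernelRelation f) := by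
  simp only [isEquivalence_iff, isReflexive_iff, isSymmetric_iff, isTransitive_iff,
    relates_kernelRelation_iff]
  exact ⟨fun _ _ => trivial, fun _ _ _ => Eq.symm, fun _ _ _ _ => Eq.trans⟩

/-- Difunctionality of `U` in terms of generalized elements. Unlike `IsDifunctional` it involves no
composite of relations, so it makes sense in every finitely complete category. -/
def IsElementwiseDifunctional (U : Relation X Y) : Prop :=
  ∀ ⦃T : C⦄ ⦃a c : T ⟶ X⦄ ⦃b d : T ⟶ Y⦄,
    Relates U a b → Relates U c b → Relates U c d → Relates U a d

theorem IsElementwiseDifunctional.isEquivalence {R : Relation X X}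
    (hd : IsElementwiseDifunctional R) (hR : IsReflexive R) : IsEquivalence R := by
  have refl := isReflexive_iff.1 hR
  refine isEquivalence_iff.2 ⟨hR, isSymmetric_iff.2 fun _ x y hxy => ?_,
    isTransitive_iff.2 fun _ x y z hxy hyz => ?_⟩
  · exact hd (refl y) hxy (refl x)
  · exact hd hxy (refl y) hyz

/-- The relation on the object `U` which relates the elements `(a, b)` and `(c, d)` of `U` when `U`
relates `a` to `d`. -/
noncomputable def crossRelation (U : Relation X Y) : Relation (U : C) (U : C) :=
  (Subobject.pullback (prod.map (proj₀ U) (proj₁ U))).obj U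

theorem relates_crossRelation_iff {U : Relation X Y} {k l : T ⟶ (U : C)} :
    Relates (crossRelation U) k l ↔ Relates U (k ≫ proj₀ U) (l ≫ proj₁ U) := by
  rw [Relates, crossRelation, pullback_factors_iff, prod.lift_map, Relates]

theorem isReflexive_crossRelation (U : Relation X Y) : IsReflexive (crossRelation U) :=
  isReflexive_iff.2 fun _ k => relates_crossRelation_iff.2 ((relates_proj U).precomp k)

theorem isElementwiseDifunctional_of_isSymmetric_crossRelation {U : Relation X Y}
    (h : IsSymmetric (crossRelation U)) : IsElementwiseDifunctional U := by
  intro T a c b d hab hcb hcd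
  obtain ⟨ab, rfl, rfl⟩ := relates_iff_exists.1 hab
  obtain ⟨cd, rfl, rfl⟩ := relates_iff_exists.1 hcd
  have cd_ab : Relates (crossRelation U) cd ab := relates_crossRelation_iff.2 hcb
  exact relates_crossRelation_iff.1 (isSymmetric_iff.1 h cd ab cd_ab)

theorem isElementwiseDifunctional_of_isTransitive_crossRelation {U : Relation X Y}
    (h : IsTransitive (crossRelation U)) : IsElementwiseDifunctional U := by
  intro T a c b d hab hcb hcd
  obtain ⟨ab, rfl, rfl⟩ := relates_iff_exists.1 hab
  obtain ⟨cb, rfl, hb⟩ := relates_iff_exists.1 hcb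
  obtain ⟨cd, -, rfl⟩ := relates_iff_exists.1 hcd
  have ab_cb : Relates (crossRelation U) ab cb := relates_crossRelation_iff.2 (hb ▸ hab)
  have cb_cd : Relates (crossRelation U) cb cd := relates_crossRelation_iff.2 hcd
  exact relates_crossRelation_iff.1 (isTransitive_iff.1 h ab cb cd ab_cb cb_cd)

variable (C) in
theorem isMaltsev_tfae :
    List.TFAE [
      IsMaltsev C,
      ∀ (X Y : C) (U : Relation X Y), IsElementwiseDifunctional U,
      ∀ (X : C) (R : Relation X X), IsReflexive R → IsSymmetric R,
      ∀ (X : C) (R : Relation X X), IsReflexive R → IsTransitive R] := by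
  tfae_have 1 → 3 := fun h X R hR => (isEquivalence_iff.1 (h X R hR)).2.1
  tfae_have 1 → 4 := fun h X R hR => (isEquivalence_iff.1 (h X R hR)).2.2
  tfae_have 2 → 1 := fun h X R => (h X X R).isEquivalence
  tfae_have 3 → 2 := fun h _ _ U =>
    isElementwiseDifunctional_of_isSymmetric_crossRelation (h _ _ (isReflexive_crossRelation U))
  tfae_have 4 → 2 := fun h _ _ U =>
    isElementwiseDifunctional_of_isTransitive_crossRelation (h _ _ (isReflexive_crossRelation U))
  tfae_finish

end FiniteLimits

section Regular

variable [Regular C] {X Y Z T : C}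

theorem relates_comp_iff {R : Relation X Y} {S : Relation Y Z} {x : T ⟶ X} {z : T ⟶ Z} :
    Relates (comp S R) x z ↔ ∃ (T' : C) (e : T' ⟶ T) (y : T' ⟶ Y),
      IsRegularEpi e ∧ Relates R (e ≫ x) y ∧ Relates S y (e ≫ z) := by
  rw [Relates, comp, mk_monoFactorisation_m_factors_iff]
  simp only [prod.comp_lift, prod_lift_eq_lift_iff]
  constructor
  · rintro ⟨T', e, k, he, hx, hz⟩
    refine ⟨T', e, k ≫ pullback.fst (proj₁ R) (proj₀ S) ≫ proj₁ R, he,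
      relates_iff_exists.2 ⟨k ≫ pullback.fst _ _, ?_, ?_⟩,
      relates_iff_exists.2 ⟨k ≫ pullback.snd _ _, ?_, ?_⟩⟩
    · rw [Category.assoc, hx]
    · rw [Category.assoc]
    · rw [Category.assoc, pullback.condition]
    · rw [Category.assoc, hz]
  · rintro ⟨T', e, y, he, hxy, hyz⟩
    obtain ⟨r, hx, rfl⟩ := relates_iff_exists.1 hxy
    obtain ⟨s, hrs, hz⟩ := relates_iff_exists.1 hyz
    refine ⟨T', e, pullback.lift r s hrs.symm, he, ?_, ?_⟩
    · rw [pullback.lift_fst_assoc, hx]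
    · rw [pullback.lift_snd_assoc, hz]

theorem Relates.comp {R : Relation X Y} {S : Relation Y Z} {x : T ⟶ X} {y : T ⟶ Y} {z : T ⟶ Z}
    (hxy : Relates R x y) (hyz : Relates S y z) : Relates (comp S R) x z :=
  relates_comp_iff.2 ⟨T, 𝟙 T, y, inferInstance, by rwa [Category.id_comp],
    by rwa [Category.id_comp]⟩

theorem isReflexive_comp {R S : Relation X X} (hR : IsReflexive R) (hS : IsReflexive S) :
    IsReflexive (comp S R) :=
  isReflexive_iff.2 fun _ x => (isReflexive_iff.1 hR x).comp (isReflexive_iff.1 hS x)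

theorem relates_comp_comm_iff {R S : Relation X X} (hR : IsSymmetric R) (hS : IsSymmetric S)
    {x z : T ⟶ X} : Relates (comp S R) x z ↔ Relates (comp R S) z x := by
  have symmR {T' : C} (a b : T' ⟶ X) : Relates R a b ↔ Relates R b a :=
    ⟨isSymmetric_iff.1 hR a b, isSymmetric_iff.1 hR b a⟩
  have symmS {T' : C} (a b : T' ⟶ X) : Relates S a b ↔ Relates S b a :=
    ⟨isSymmetric_iff.1 hS a b, isSymmetric_iff.1 hS b a⟩
  simp only [relates_comp_iff, symmR (_ ≫ x), symmS _ (_ ≫ z), and_comm (a := Relates R _ _)]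

theorem comp_comm_of_isSymmetric {R S : Relation X X} (hR : IsSymmetric R) (hS : IsSymmetric S)
    (hSR : IsSymmetric (comp S R)) : comp S R = comp R S := by
  have symm := isSymmetric_iff.1 hSR
  refine le_antisymm (le_iff_forall_relates.2 fun T x z h => ?_)
    (le_iff_forall_relates.2 fun T x z h => ?_)
  · exact (relates_comp_comm_iff hR hS).1 (symm x z h)
  · exact symm z x ((relates_comp_comm_iff hR hS).2 h)

theorem isDifunctional_iff_isElementwiseDifunctional {U : Relation X Y} :
    IsDifunctional U ↔ IsElementwiseDifunctional U := by
  rw [IsDifunctional, le_iff_forall_relates]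
  constructor
  · intro h T a c b d hab hcb hcd
    exact h a d ((hab.comp (relates_opposite_iff.2 hcb)).comp hcd)
  · intro h T a d had
    obtain ⟨T₁, e₁, c, _, hac, hcd⟩ := relates_comp_iff.1 had
    obtain ⟨T₂, e₂, b, _, hab, hbc⟩ := relates_comp_iff.1 hac
    rw [← relates_strongEpi_comp_iff e₁, ← relates_strongEpi_comp_iff e₂]
    exact h hab (relates_opposite_iff.1 hbc) (hcd.precomp e₂)

theorem isElementwiseDifunctional_of_comp_kernelRelation_le {U : Relation X Y}
    (h : comp (kernelRelation (proj₀ U)) (kernelRelation (proj₁ U)) ≤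
      comp (kernelRelation (proj₁ U)) (kernelRelation (proj₀ U))) :
    IsElementwiseDifunctional U := by
  intro T a c b d hab hcb hcd
  obtain ⟨ab, rfl, rfl⟩ := relates_iff_exists.1 hab
  obtain ⟨cb, rfl, hb⟩ := relates_iff_exists.1 hcb
  obtain ⟨cd, hc, rfl⟩ := relates_iff_exists.1 hcd
  have ab_cd := (relates_kernelRelation_iff.2 hb.symm).comp (relates_kernelRelation_iff.2 hc.symm)
  obtain ⟨T', e, ad, _, ha, hd⟩ := relates_comp_iff.1 (le_iff_forall_relates.1 h ab cd ab_cd)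
  rw [relates_kernelRelation_iff, Category.assoc] at ha hd
  rw [← relates_strongEpi_comp_iff e, ha, ← hd]
  exact (relates_proj U).precomp ad

end Regular

end InternalRelation

theorem mainTheorem4 (C : Type u) [Category.{v} C] [Regular C] :
    List.TFAE [
      ∀ (X : C) (R S : InternalRelation.Relation X X),
        InternalRelation.IsEquivalence R → InternalRelation.IsEquivalence S →
          InternalRelation.comp S R = InternalRelation.comp R S,
      ∀ (X Y : C) (U : InternalRelation.Relation X Y), InternalRelation.IsDifunctional U,
      InternalRelation.IsMaltsev C,
      ∀ (X : C) (R : InternalRelation.Relation X X),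
        InternalRelation.IsReflexive R → InternalRelation.IsSymmetric R,
      ∀ (X : C) (R : InternalRelation.Relation X X),
        InternalRelation.IsReflexive R → InternalRelation.IsTransitive R] := by
  have maltsev := InternalRelation.isMaltsev_tfae C
  simp only [InternalRelation.isDifunctional_iff_isElementwiseDifunctional]
  tfae_have 1 → 2 := fun h X Y U =>
    InternalRelation.isElementwiseDifunctional_of_comp_kernelRelation_le
      (h _ _ _ (InternalRelation.isEquivalence_kernelRelation _)
        (InternalRelation.isEquivalence_kernelRelation _)).le
  tfae_have 3 ↔ 2 := maltsev.out 0 1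
  tfae_have 3 ↔ 4 := maltsev.out 0 2
  tfae_have 3 ↔ 5 := maltsev.out 0 3
  tfae_have 4 → 1 := by
    intro symm X R S hR hS
    obtain ⟨hRr, hRs, -⟩ := InternalRelation.isEquivalence_iff.1 hR
    obtain ⟨hSr, hSs, -⟩ := InternalRelation.isEquivalence_iff.1 hS
    exact InternalRelation.comp_comm_of_isSymmetric hRs hSs
      (symm X _ (InternalRelation.isReflexive_comp hRr hSr))
  tfae_finish
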